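/- Let $\alpha$ be an ordinal and let $[1,\alpha]$ carry the order topology. A function $x\colon[1,\alpha]\to\mathbb R$ is of Baire class $1$ if it is the pointwise limit of a sequence of continuous functions, and, for a countable ordinal $\gamma>1$, of Baire class $\gamma$ if it is the pointwise limit of a sequence $(f_n)$ of functions with $f_n$ of Baire class $\beta_n$ for some $1\le\beta_n<\gamma$. Let $B_p[1,\alpha]$ be the set of all Baire functions $[1,\alpha]\to\mathbb R$ (those of some class $\gamma$, $1\le\gamma<\omega_1$) with the topology of pointwise convergence. A space is realcompact if it is homeomorphic to a closed subspace of a product of real lines. A realcompactification of a space $X$ is a realcompact space $\nu X$ together with a homeomorphic embedding $\nu\colon X\to\nu X$ with dense image such that every continuous function $f\colon X\to\mathbb R$ extends continuously over $\nu X$, that is, there is a continuous $\tilde f\colon\nu X\to\mathbb R$ with $\tilde f\circ\nu=f$. Then the realcompactification $\nu B_p[1,\alpha]$ is canonically homeomorphic to the Tychonoff product $\mathbb R^{[1,\alpha]}$. Precisely: the inclusion $B_p[1,\alpha]\hookrightarrow\mathbb R^{[1,\alpha]}$ is a realcompactification of $B_p[1,\alpha]$, and for every realcompactification $\nu\colon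 B_p[1,\alpha]\to Y$ there is exactly one homeomorphism $h\colon Y\to\mathbb R^{[1,\alpha]}$ such that $h(\nu(x))=x$ for all $x\in B_p[1,\alpha]$. -/

import Mathlib

open Filter Topology

universe u v w

/-- `IsBaireOfClass γ x`: the real function `x` on the topological space `X` is of Baire class `γ`,
where `1 ≤ γ < ω₁`.  Class `1` consists of the pointwise limits of sequences of continuous
functions; for `1 < γ < ω₁`, class `γ` consists of the pointwise limits of sequences `f n` with
`f n` of class `β n < γ`. (No function is of class `0` or of class `γ ≥ ω₁` in this convention.) -/
inductive IsBaireOfClass {X : Type v} [TopologicalSpace X] : Ordinal.{0} → (X → ℝ) → Prop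
  | one (f : ℕ → X → ℝ) (x : X → ℝ) (hf : ∀ n, Continuous (f n))
      (hx : ∀ t, Tendsto (fun n => f n t) atTop (𝓝 (x t))) : IsBaireOfClass 1 x
  | limit (γ : Ordinal.{0}) (h1 : 1 < γ) (hγ : γ < Ordinal.omega 1)
      (β : ℕ → Ordinal.{0}) (hβ : ∀ n, β n < γ)
      (f : ℕ → X → ℝ) (x : X → ℝ) (hf : ∀ n, IsBaireOfClass (β n) (f n))
      (hx : ∀ t, Tendsto (fun n => f n t) atTop (𝓝 (x t))) : IsBaireOfClass γ x

/-- The interval of ordinals `[1, α]`. Its topology is the one inherited from `Ordinal`, which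
is its order topology. -/
abbrev OrdinalInterval (α : Ordinal.{u}) : Type (u + 1) := Set.Icc (1 : Ordinal.{u}) α

/-- The set of all Baire functions `[1, α] → ℝ` (of any class `1 ≤ γ < ω₁`). As a subspace of
the product `OrdinalInterval α → ℝ` it carries the topology of pointwise convergence: this is the
space `B_p[1, α]`. -/
def BaireFunctions (α : Ordinal.{u}) : Set (OrdinalInterval α → ℝ) :=
  {x | ∃ γ : Ordinal.{0}, IsBaireOfClass γ x}

/-- A space is realcompact if it is homeomorphic to a closed subspace of a product of real lines.
(Taking the index set in the universe of `X` loses nothing: if such an embedding exists for some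
index set, then one exists with the set of continuous real functions on `X` as index set.) -/
def IsRealcompact (X : Type v) [TopologicalSpace X] : Prop :=
  ∃ (ι : Type v) (e : X → ι → ℝ), IsClosedEmbedding e

/-- `ν : X → Y` exhibits `Y` as a realcompactification of `X`: the space `Y` is realcompact, `ν` is
a homeomorphic embedding with dense image, and every continuous real function on `X` extends
continuously over `Y`. -/
structure IsRealcompactification {X : Type v} {Y : Type w} [TopologicalSpace X]
    [TopologicalSpace Y] (ν : X → Y) : Prop where
  realcompact : IsRealcompact Y
  isEmbedding : IsEmbedding ν
  denseRange : DenseRange ν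
  exists_extension : ∀ f : X → ℝ, Continuous f →
    ∃ g : Y → ℝ, Continuous g ∧ ∀ x, g (ν x) = f x

/-! Any values on a countable subset of $[1,\alpha]$ are taken by a Baire function of class at most
2, so $B_p[1,\alpha]$ projects onto every countable subproduct. A subspace $S\subseteq\mathbb R^T$
with this property is dense, and a continuous $f$ on $S$ depends on countably many coordinates $A$:
by the countable chain condition closures of open sets do, and this is applied to extensions of the
preimages of rational rays. The extension of $f$ at $z$ is its value at any point of $S$ agreeing
with $z$ on $A$. Uniqueness is the universal property. -/

/-! ### Chain condition and countable supports -/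

/-- The nonempty open boxes of `T → ℝ` that restrict only the coordinates in a finite set. -/
def IsOpenBox {T : Type v} (s : Set (T → ℝ)) : Prop :=
  s.Nonempty ∧ ∃ (F : Finset T) (U : T → Set ℝ), (∀ i ∈ F, IsOpen (U i)) ∧ s = (F : Set T).pi U

theorem IsOpenBox.isOpen {T : Type v} {s : Set (T → ℝ)} (h : IsOpenBox s) : IsOpen s := by
  obtain ⟨-, F, U, hU, rfl⟩ := h
  exact isOpen_set_pi F.finite_toSet hU

theorem exists_isOpenBox_subset {T : Type v} {W : Set (T → ℝ)} (hW : IsOpen W) {x : T → ℝ}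
    (hx : x ∈ W) : ∃ s, IsOpenBox s ∧ x ∈ s ∧ s ⊆ W := by
  obtain ⟨F, U, hU, hs⟩ := isOpen_pi_iff.1 hW x hx
  have hxs : x ∈ (F : Set T).pi U := fun i hi => (hU i hi).2
  exact ⟨_, ⟨⟨x, hxs⟩, F, U, fun i hi => (hU i hi).1, rfl⟩, hxs, hs⟩

/-- A power of the real line satisfies the countable chain condition. -/
theorem countable_of_pairwiseDisjoint_isOpenBox {T : Type v} {C : Set (Set (T → ℝ))}
    (hC : ∀ s ∈ C, IsOpenBox s) (hd : C.PairwiseDisjoint id) : C.Countable := by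
  -- A product of fully supported probability measures gives every nonempty box positive mass, and
  -- only countably many disjoint sets can have positive mass.
  let μ := MeasureTheory.Measure.infinitePi
    (fun _ : T => ProbabilityTheory.gaussianReal 0 1)
  have hpos : (ProbabilityTheory.gaussianReal 0 1).IsOpenPosMeasure :=
    (ProbabilityTheory.gaussianReal_absolutelyContinuous' 0 one_ne_zero).isOpenPosMeasure
  have hbox : ∀ s, IsOpenBox s → MeasurableSet s ∧ 0 < μ s := by
    rintro s ⟨⟨x, hx⟩, F, U, hU, rfl⟩
    have hm : ∀ i ∈ F, MeasurableSet (U i) := fun i hi => (hU i hi).measurableSet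
    refine ⟨MeasurableSet.pi F.countable_toSet hm, ?_⟩
    rw [MeasureTheory.Measure.infinitePi_pi _ hm, CanonicallyOrderedAdd.prod_pos]
    exact fun i hi => (hU i hi).measure_pos _ ⟨x i, hx i hi⟩
  have h := MeasureTheory.Measure.countable_meas_pos_of_disjoint_iUnion (μ := μ)
    (As := fun s : C => (s : Set (T → ℝ))) (fun s => (hbox s (hC s s.2)).1)
    (fun s t hst => hd s.2 t.2 (Subtype.coe_injective.ne hst))
  have huniv : {s : C | 0 < μ (s : Set (T → ℝ))} = Set.univ :=
    Set.eq_univ_of_forall fun s => (hbox s (hC s s.2)).2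
  rw [huniv, Set.countable_univ_iff] at h
  exact h

/-- Translating by `y - x` does not change the coordinates at which `x` and `y` agree. -/
theorem isOpen_preimage_add_sub {T : Type v} {W : Set (T → ℝ)} (hW : IsOpen W) (x y : T → ℝ) :
    IsOpen {z : T → ℝ | z + (y - x) ∈ W} :=
  hW.preimage (continuous_id.add continuous_const)

/-- The closure of an open subset of `T → ℝ` is determined by countably many coordinates. -/
theorem exists_countable_forall_mem_closure {T : Type v} {W : Set (T → ℝ)} (hW : IsOpen W) :
    ∃ A : Set T, A.Countable ∧ ∀ x ∈ W, ∀ y : T → ℝ, Set.EqOn x y A → y ∈ closure W := by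
  -- By maximality the union of these disjoint boxes is dense in `W`.
  obtain ⟨C, hC⟩ := zorn_subset
    {C : Set (Set (T → ℝ)) | (∀ s ∈ C, IsOpenBox s ∧ s ⊆ W) ∧ C.PairwiseDisjoint id} (by
      intro c hc hchain
      refine ⟨⋃₀ c, ⟨?_, ?_⟩, fun s hs => Set.subset_sUnion_of_mem hs⟩
      · rintro s ⟨D, hD, hs⟩
        exact (hc hD).1 s hs
      · exact (Set.pairwiseDisjoint_sUnion hchain.directedOn).2 fun D hD => (hc hD).2)
  have hCcount : C.Countable :=
    countable_of_pairwiseDisjoint_isOpenBox (fun s hs => (hC.prop.1 s hs).1) hC.prop.2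
  have hsupp : ∀ s : C, ∃ F : Finset T, ∀ x ∈ (s : Set (T → ℝ)), ∀ y : T → ℝ,
      Set.EqOn x y F → y ∈ (s : Set (T → ℝ)) := by
    rintro ⟨s, hs⟩
    obtain ⟨⟨-, F, U, -, rfl⟩, -⟩ := hC.prop.1 s hs
    exact ⟨F, fun x hx y hxy i hi => hxy hi ▸ hx i hi⟩
  choose F hF using hsupp
  have : Countable C := hCcount
  refine ⟨⋃ s, (F s : Set T), Set.countable_iUnion fun s => (F s).countable_toSet, ?_⟩
  intro x hx y hxy
  have hxcl : x ∈ closure (⋃₀ C) := by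
    by_contra hcon
    obtain ⟨s, hsbox, hxs, hsub⟩ := exists_isOpenBox_subset
      (hW.inter isClosed_closure.isOpen_compl) (show x ∈ W ∩ (closure (⋃₀ C))ᶜ from ⟨hx, hcon⟩)
    have hdisj : ∀ t ∈ C, Disjoint s t := fun t ht => Set.disjoint_left.2 fun z hzs hzt =>
      (hsub hzs).2 (subset_closure ⟨t, ht, hzt⟩)
    have hmem : s ∈ C := by
      refine hC.le_of_ge (y := insert s C) ⟨?_, ?_⟩ (Set.subset_insert s C)
        (Set.mem_insert s C)
      · rintro t (rfl | ht)
        · exact ⟨hsbox, fun z hz => (hsub hz).1⟩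
        · exact hC.prop.1 t ht
      · exact hC.prop.2.insert fun t ht _ => hdisj t ht
    exact (hsub hxs).2 (subset_closure ⟨s, hmem, hxs⟩)
  refine closure_mono (Set.sUnion_subset fun s hs => (hC.prop.1 s hs).2) ?_
  rw [mem_closure_iff] at hxcl ⊢
  intro N hN hyN
  -- The translate of `z` lies in `N` and keeps the coordinates supporting `s`, so it stays in `s`.
  obtain ⟨z, hz, s, hs, hzs⟩ := hxcl _ (isOpen_preimage_add_sub hN x y) (by simpa using hyN)
  refine ⟨_, hz, s, hs, hF ⟨s, hs⟩ z hzs _ fun i hi => ?_⟩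
  have := hxy (Set.mem_iUnion_of_mem _ hi)
  simp [this]

/-! ### Extension from the subspace to the full product -/

/-- If `S ⊆ T → ℝ` projects onto every countable subproduct, then it is dense. -/
theorem dense_of_forall_countable_exists_eqOn {T : Type v} {S : Set (T → ℝ)}
    (hS : ∀ A : Set T, A.Countable → ∀ z : T → ℝ, ∃ y ∈ S, Set.EqOn y z A) : Dense S := by
  refine dense_iff_inter_open.2 ?_
  rintro W hW ⟨z, hz⟩
  obtain ⟨s, ⟨-, F, U, -, rfl⟩, hzs, hsW⟩ := exists_isOpenBox_subset hW hz
  obtain ⟨y, hyS, hy⟩ := hS F F.countable_toSet z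
  exact ⟨y, hsW fun i hi => by rw [hy hi]; exact hzs i hi, hyS⟩

/-- If `S ⊆ T → ℝ` projects onto every countable subproduct, then every continuous real function
on `S` extends continuously over `T → ℝ`. -/
theorem exists_continuous_extension_of_forall_countable {T : Type v} {S : Set (T → ℝ)}
    (hS : ∀ A : Set T, A.Countable → ∀ z : T → ℝ, ∃ y ∈ S, Set.EqOn y z A)
    (f : S → ℝ) (hf : Continuous f) :
    ∃ g : (T → ℝ) → ℝ, Continuous g ∧ ∀ x : S, g x = f x := by
  have hdense := dense_of_forall_countable_exists_eqOn hS
  have hext : ∀ V : Set ℝ, IsOpen V →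
      ∃ W : Set (T → ℝ), IsOpen W ∧ ∀ x : S, (x : T → ℝ) ∈ W ↔ f x ∈ V := by
    intro V hV
    obtain ⟨W, hW, hWV⟩ := isOpen_induced_iff.1 (hV.preimage hf)
    exact ⟨W, hW, fun x => Set.ext_iff.1 hWV x⟩
  choose L hLo hL using fun q : ℚ => hext (Set.Iio (q : ℝ)) isOpen_Iio
  choose R hRo hR using fun q : ℚ => hext (Set.Ioi (q : ℝ)) isOpen_Ioi
  choose AL hALc hAL using fun q : ℚ => exists_countable_forall_mem_closure (hLo q)
  choose AR hARc hAR using fun q : ℚ => exists_countable_forall_mem_closure (hRo q)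
  let A : Set T := (⋃ q, AL q) ∪ ⋃ q, AR q
  have hAc : A.Countable := (Set.countable_iUnion hALc).union (Set.countable_iUnion hARc)
  have hLR : ∀ q, Disjoint (L q) (R q) := by
    intro q
    rw [Set.disjoint_iff_inter_eq_empty, ← Set.not_nonempty_iff_eq_empty]
    intro hne
    obtain ⟨z, ⟨hzL, hzR⟩, hzS⟩ := hdense.inter_open_nonempty _ ((hLo q).inter (hRo q)) hne
    exact lt_asymm (Set.mem_Iio.1 ((hL q ⟨z, hzS⟩).1 hzL)) (Set.mem_Ioi.1 ((hR q ⟨z, hzS⟩).1 hzR))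
  have hleft : ∀ (q : ℚ) (w : T → ℝ), w ∈ L q → ∀ y : S, Set.EqOn w y A → f y ≤ q := by
    intro q w hw y hwy
    by_contra hlt
    have hy : (y : T → ℝ) ∈ closure (L q) := hAL q w hw y
      (hwy.mono ((Set.subset_iUnion AL q).trans Set.subset_union_left))
    exact Set.disjoint_left.1 ((hLR q).closure_left (hRo q)) hy ((hR q y).2 (not_le.1 hlt))
  have hright : ∀ (q : ℚ) (w : T → ℝ), w ∈ R q → ∀ y : S, Set.EqOn w y A → q ≤ f y := by
    intro q w hw y hwy
    by_contra hlt
    have hy : (y : T → ℝ) ∈ closure (R q) := hAR q w hw y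
      (hwy.mono ((Set.subset_iUnion AR q).trans Set.subset_union_right))
    exact Set.disjoint_left.1 ((hLR q).symm.closure_left (hLo q)) hy ((hL q y).2 (not_le.1 hlt))
  choose p hpS hp using hS A hAc
  have hpt : ∀ z, ContinuousAt (fun z => f ⟨p z, hpS z⟩) z := by
    intro z
    -- `p` itself need not be continuous; the translate of `z'` is, and it agrees with `p z'` on
    -- `A`.
    have hshift : ∀ z' : T → ℝ,
        Set.EqOn (z' + (p z - z)) (p z') A := fun z' i hi => by simp [hp z hi, hp z' hi]
    refine tendsto_order.2 ⟨fun a ha => ?_, fun b hb => ?_⟩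
    · obtain ⟨q, haq, hq⟩ := exists_rat_btwn ha
      filter_upwards [(isOpen_preimage_add_sub (hRo q) z (p z)).mem_nhds
        (by simpa using (hR q ⟨p z, hpS z⟩).2 hq)] with z' hz'
      exact haq.trans_le (hright q _ hz' ⟨p z', hpS z'⟩ (hshift z'))
    · obtain ⟨q, hq, hqb⟩ := exists_rat_btwn hb
      filter_upwards [(isOpen_preimage_add_sub (hLo q) z (p z)).mem_nhds
        (by simpa using (hL q ⟨p z, hpS z⟩).2 hq)] with z' hz'
      exact (hleft q _ hz' ⟨p z', hpS z'⟩ (hshift z')).trans_lt hqb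
  refine ⟨_, continuous_iff_continuousAt.2 hpt, fun x => le_antisymm ?_ ?_⟩
  · refine le_of_forall_gt_imp_ge_of_dense fun b hb => ?_
    obtain ⟨q, hq, hqb⟩ := exists_rat_btwn hb
    exact (hleft q x ((hL q x).2 hq) _ (hp x).symm).trans hqb.le
  · refine le_of_forall_lt_imp_le_of_dense fun a ha => ?_
    obtain ⟨q, haq, hq⟩ := exists_rat_btwn ha
    exact haq.le.trans (hright q x ((hR q x).2 hq) _ (hp x).symm)

/-! ### Baire functions with prescribed countable values -/

theorem isClopen_setOf_gt_ordinalInterval {α : Ordinal.{u}} (b : OrdinalInterval α) :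
    IsClopen {s : OrdinalInterval α | b < s} := by
  refine ⟨?_, isOpen_Ioi⟩
  have h : {s : OrdinalInterval α | b < s} =
      Subtype.val ⁻¹' Set.Ici (Order.succ (b : Ordinal.{u})) := by
    ext s
    simp
  rw [h]
  exact isClosed_Ici.preimage continuous_subtype_val

theorem isClopen_setOf_le_ordinalInterval {α : Ordinal.{u}} (a : OrdinalInterval α) :
    IsClopen {s : OrdinalInterval α | s ≤ a} := by
  have h : {s : OrdinalInterval α | s ≤ a} = {s | a < s}ᶜ := by
    ext s
    simp
  rw [h]
  exact (isClopen_setOf_gt_ordinalInterval a).compl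

/-- Every real function on a countable subset of `[1, α]` extends to a Baire function. -/
theorem exists_baireFunction_eqOn {α : Ordinal.{u}} (A : Set (OrdinalInterval α))
    (hA : A.Countable) (z : OrdinalInterval α → ℝ) :
    ∃ x ∈ BaireFunctions α, Set.EqOn x z A := by
  classical
  rcases A.eq_empty_or_nonempty with rfl | hne
  · exact ⟨0, ⟨1, .one (fun _ => 0) 0 (fun _ => continuous_const) fun _ => tendsto_const_nhds⟩,
      Set.eqOn_empty _ _⟩
  obtain ⟨a, rfl⟩ := hA.exists_eq_range hne
  -- `E n` reaches down from `a n` to the supremum of the smaller `a k`; the clopen sets `K n m`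
  -- decrease to it. `c n` vanishes at repetitions in the enumeration.
  let K : ℕ → ℕ → Set (OrdinalInterval α) := fun n m =>
    {s | s ≤ a n ∧ ∀ k < m, a k < a n → a k < s}
  let E : ℕ → Set (OrdinalInterval α) := fun n => {s | s ≤ a n ∧ ∀ k, a k < a n → a k < s}
  let c : ℕ → ℝ := fun n => if ∃ m < n, a m = a n then 0 else z (a n)
  have hKclopen : ∀ n m, IsClopen (K n m) := by
    intro n m
    have h : K n m = {s | s ≤ a n} ∩ ⋂ k ∈ Finset.range m, {s | a k < a n → a k < s} := by
      ext s
      simp [K]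
    rw [h]
    refine (isClopen_setOf_le_ordinalInterval _).inter (isClopen_biInter_finset fun k _ => ?_)
    by_cases hk : a k < a n
    · simpa [hk] using isClopen_setOf_gt_ordinalInterval (a k)
    · simp [hk, isClopen_univ]
  have hKE : ∀ n s, Tendsto (fun m => (K n m).indicator (fun _ => c n) s) atTop
      (𝓝 ((E n).indicator (fun _ => c n) s)) := by
    intro n s
    refine tendsto_const_nhds.congr' ?_
    by_cases hs : s ∈ E n
    · refine Eventually.of_forall fun m => ?_
      have : s ∈ K n m := ⟨hs.1, fun k _ => hs.2 k⟩
      simp [hs, this]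
    · by_cases hle : s ≤ a n
      · have : ∃ k, a k < a n ∧ ¬ a k < s := by
          by_contra! hcon
          exact hs ⟨hle, hcon⟩
        obtain ⟨k, hk, hks⟩ := this
        filter_upwards [eventually_gt_atTop k] with m hm
        have : s ∉ K n m := fun h => hks (h.2 k hm hk)
        simp [hs, this]
      · refine Eventually.of_forall fun m => ?_
        have : s ∉ K n m := fun h => hle h.1
        simp [hs, this]
  have hfirst : ∀ n, c n ≠ 0 → ∀ m < n, a m ≠ a n := by
    intro n hn m hm heq
    exact hn (if_pos ⟨m, hm, heq⟩)
  have huniq : ∀ s n m, (E n).indicator (fun _ => c n) s ≠ 0 →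
      (E m).indicator (fun _ => c m) s ≠ 0 → n = m := by
    intro s n m hn hm
    have hsn := Set.mem_of_indicator_ne_zero hn
    have hsm := Set.mem_of_indicator_ne_zero hm
    rw [Set.indicator_of_mem hsn] at hn
    rw [Set.indicator_of_mem hsm] at hm
    have heq : a n = a m := by
      rcases lt_trichotomy (a n) (a m) with h | h | h
      · exact absurd (hsm.2 n h) hsn.1.not_gt
      · exact h
      · exact absurd (hsn.2 m h) hsm.1.not_gt
    rcases lt_trichotomy n m with h | h | h
    · exact absurd heq (hfirst m hm n h)
    · exact h
    · exact absurd heq.symm (hfirst n hn m h)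
  have hsum : ∀ s, Summable fun n => (E n).indicator (fun _ => c n) s := by
    intro s
    refine summable_of_hasFiniteSupport (Set.Subsingleton.finite ?_)
    exact fun n hn m hm => huniq s n m hn hm
  refine ⟨fun s => ∑' n, (E n).indicator (fun _ => c n) s,
    ⟨2, .limit 2 one_lt_two ?_ (fun _ => 1) (fun _ => one_lt_two)
      (fun N s => ∑ n ∈ Finset.range N, (E n).indicator (fun _ => c n) s) _ (fun N => ?_)
      fun s => (hsum s).hasSum.tendsto_sum_nat⟩, ?_⟩
  · exact (Ordinal.natCast_lt_omega0 2).trans_le (Ordinal.omega0_le_omega 1)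
  · refine .one (fun m s => ∑ n ∈ Finset.range N, (K n m).indicator (fun _ => c n) s) _
      (fun m => ?_) fun s => tendsto_finsetSum _ fun n _ => hKE n s
    exact continuous_finsetSum _ fun n _ => continuous_const.indicator (by simp [(hKclopen n m).frontier_eq])
  · rintro _ ⟨j, rfl⟩
    have hex : ∃ n, a n = a j := ⟨j, rfl⟩
    obtain ⟨n, hn, hmin⟩ : ∃ n, a n = a j ∧ ∀ m < n, a m ≠ a n :=
      ⟨Nat.find hex, Nat.find_spec hex, fun m hm heq =>
        Nat.find_min hex hm (heq.trans (Nat.find_spec hex))⟩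
    have hc : c n = z (a n) := if_neg fun ⟨m, hm, heq⟩ => hmin m hm heq
    have hmem : a n ∈ E n := ⟨le_rfl, fun k hk => hk⟩
    have hval : (E n).indicator (fun _ => c n) (a n) = z (a n) := by
      rw [Set.indicator_of_mem hmem, hc]
    dsimp only
    rw [← hn]
    -- `huniq` compares only nonzero terms, so the value zero is treated apart.
    by_cases hz : z (a n) = 0
    · rw [hz]
      refine (tsum_congr fun m => ?_).trans tsum_zero
      by_contra hm
      have hsm := Set.mem_of_indicator_ne_zero hm
      rw [Set.indicator_of_mem hsm] at hm
      have heq : a m = a n := by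
        rcases hsm.1.lt_or_eq with h | h
        · exact absurd (hsm.2 n h) (lt_irrefl _)
        · exact h.symm
      have hmn : c m = z (a m) := if_neg fun h => hm (if_pos h)
      exact hm (by rw [hmn, heq, hz])
    · rw [tsum_eq_single n, hval]
      intro m hmn
      by_contra hm
      exact hmn (huniq _ m n hm (by rwa [hval]))

/-! ### Uniqueness of realcompactifications -/

/-- A continuous map into a realcompact space extends over every realcompactification of its
domain. -/
theorem IsRealcompactification.exists_continuous_extension {X : Type*} {Y : Type*} {Z : Type*}
    [TopologicalSpace X] [TopologicalSpace Y] [TopologicalSpace Z] {ν : X → Y}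
    (hν : IsRealcompactification ν) (hZ : IsRealcompact Z) {f : X → Z} (hf : Continuous f) :
    ∃ g : Y → Z, Continuous g ∧ ∀ x, g (ν x) = f x := by
  obtain ⟨ι, e, he⟩ := hZ
  choose G hGc hG using fun i : ι => hν.exists_extension (fun x => e (f x) i)
    ((continuous_apply i).comp (he.continuous.comp hf))
  have hcont : Continuous fun y i => G i y := continuous_pi hGc
  -- The closed range of `e` contains the image of the dense set `ν(X)`, hence that of all of `Y`.
  have hrange : ∀ y, (fun i => G i y) ∈ Set.range e := by
    intro y
    refine hν.denseRange.induction_on (p := fun y => (fun i => G i y) ∈ Set.range e) y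
      (he.isClosed_range.preimage hcont) fun x => ⟨f x, ?_⟩
    ext i
    exact (hG i x).symm
  choose g hg using hrange
  refine ⟨g, he.isEmbedding.continuous_iff.2 ?_, fun x => he.injective ?_⟩
  · exact (show e ∘ g = fun y i => G i y from funext hg) ▸ hcont
  · rw [hg]
    ext i
    exact hG i x

theorem IsRealcompact.t2Space {X : Type*} [TopologicalSpace X] (h : IsRealcompact X) :
    T2Space X := by
  obtain ⟨_, _, he⟩ := h
  exact he.isEmbedding.t2Space

/-- Any two realcompactifications of a space are canonically homeomorphic. -/
theorem IsRealcompactification.existsUnique_homeomorph {X : Type*} {Y : Type*} {Z : Type*}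
    [TopologicalSpace X] [TopologicalSpace Y] [TopologicalSpace Z] {ν : X → Y} {ξ : X → Z}
    (hν : IsRealcompactification ν) (hξ : IsRealcompactification ξ) :
    ∃! h : Y ≃ₜ Z, ∀ x, h (ν x) = ξ x := by
  have := hν.realcompact.t2Space
  have := hξ.realcompact.t2Space
  obtain ⟨g, hgc, hg⟩ := hν.exists_continuous_extension hξ.realcompact hξ.isEmbedding.continuous
  obtain ⟨k, hkc, hk⟩ := hξ.exists_continuous_extension hν.realcompact hν.isEmbedding.continuous
  have hkg : k ∘ g = id := hν.denseRange.equalizer (hkc.comp hgc) continuous_id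
    (funext fun x => by simp [hg, hk])
  have hgk : g ∘ k = id := hξ.denseRange.equalizer (hgc.comp hkc) continuous_id
    (funext fun x => by simp [hg, hk])
  refine ⟨⟨⟨g, k, congrFun hkg, congrFun hgk⟩, hgc, hkc⟩, hg, fun h hh => ?_⟩
  exact DFunLike.coe_injective (hν.denseRange.equalizer h.continuous hgc
    (funext fun x => (hh x).trans (hg x).symm))

theorem isRealcompactification_baireFunctions (α : Ordinal.{u}) :
    IsRealcompactification
      (fun x : BaireFunctions α => (x : OrdinalInterval α → ℝ)) where
  realcompact := ⟨OrdinalInterval α, id, .id⟩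
  isEmbedding := .subtypeVal
  denseRange := (dense_of_forall_countable_exists_eqOn exists_baireFunction_eqOn).denseRange_val
  exists_extension := exists_continuous_extension_of_forall_countable exists_baireFunction_eqOn

theorem mainTheorem5 (α : Ordinal.{u}) :
    IsRealcompactification
        (fun x : BaireFunctions α => (x : OrdinalInterval α → ℝ)) ∧
      ∀ (Y : Type w) [TopologicalSpace Y] (ν : BaireFunctions α → Y),
        IsRealcompactification ν →
          ∃! h : Y ≃ₜ (OrdinalInterval α → ℝ),
            ∀ x : BaireFunctions α, h (ν x) = (x : OrdinalInterval α → ℝ) :=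
  ⟨isRealcompactification_baireFunctions α, fun _ _ _ hν =>
    hν.existsUnique_homeomorph (isRealcompactification_baireFunctions α)⟩
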